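/- Let $d \ge 1$. Let $F$ be the $d\times d$ matrix $F_{jk} = \frac{1}{\sqrt d}\exp\left(-\frac{2\pi i}{d}jk\right)$, $0\le j,k\le d-1$, let $$B = \frac{1+i}{2}F + \frac{1-i}{2}F^\dagger ,\qquad Q(t) = \exp(itB)\quad (t\in\mathbb R),$$ and let $P_1$ be the orthogonal projection of $\mathbb C^d\otimes\mathbb C^d$ onto the span of $\{|j\rangle\otimes|j\rangle\}_{j=0}^{d-1}$, where $|0\rangle,\dots,|d-1\rangle$ is the standard basis of $\mathbb C^d$. For a $d\times d$ matrix $U$ write $P_1^{U^{\otimes 2}} = (U\otimes U)P_1(U\otimes U)^\dagger$. Put $$q(d) = \begin{cases} 0, & d\equiv 1,2,4,5 \pmod 8,\\ \sqrt d, & d\equiv 7 \pmod 8,\\ -\sqrt d, & d\equiv 3 \pmod 8,\\ \sqrt{2d}, & d\equiv 0,6 \pmod 8,\end{cases}$$ $$a(d) = \frac{2d-1}{2} - \frac{2q(d)}{d} - \frac{\gcd(4,d)}{2d},\qquad b(d) = -2(d-1)+\frac{2q(d)}{d},\qquad c(d) = d-\frac{2d}{d+1},$$ and $\Delta(d) =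 b(d)^2-4a(d)c(d)$. Then for every $t\in\mathbb R$ $$Q(t) = \cos(t)\,\mathbb 1 + i\sin(t)\,B,\qquad \operatorname{Tr}\left(P_1\, P_1^{Q(t)^{\otimes 2}}\right) = a(d)\sin^4 t + b(d)\sin^2 t + d .$$ Moreover, if $d\ge 2$, then $a(d)\neq 0$, $\Delta(d)\ge 0$, and $$x^\ast = \frac{-b(d)-\sqrt{\Delta(d)}}{2a(d)}$$ satisfies $0<x^\ast<1$ and $a(d)(x^\ast)^2+b(d)x^\ast+c(d)=0$; and for $t\in\mathbb R$ one has $$\operatorname{Tr}\left(P_1\, P_1^{Q(t)^{\otimes 2}}\right) = \frac{2d}{d+1}$$ if and only if $t = \arcsin(\sqrt{x^\ast})+k\pi$ or $t = -\arcsin(\sqrt{x^\ast})+k\pi$ for some $k\in\mathbb Z$. -/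

import Mathlib

namespace GroupDesign

open scoped Kronecker Matrix

/-! Operators on `ℂ^d` are `d × d` complex matrices. Operators on `ℂ^d ⊗ ℂ^d` are matrices indexed
by `Fin d × Fin d`, where the pair `(j, k)` labels the basis vector `|j⟩ ⊗ |k⟩`, so that the tensor
product of operators is the Kronecker product. -/

/-- The subspace `V₁` of `ℂ^d ⊗ ℂ^d` spanned by the vectors `|j⟩ ⊗ |j⟩`. -/
noncomputable def diagSubspace (d : ℕ) : Submodule ℂ (EuclideanSpace ℂ (Fin d × Fin d)) :=
  Submodule.span ℂ (Set.range fun j : Fin d => EuclideanSpace.single (j, j) (1 : ℂ))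

/-- The matrix of the orthogonal projection `P₁` onto `V₁`. -/
noncomputable def P₁ (d : ℕ) : Matrix (Fin d × Fin d) (Fin d × Fin d) ℂ :=
  Matrix.toEuclideanLin.symm ((diagSubspace d).starProjection : _ →ₗ[ℂ] _)

/-- `M` rotated by `U ⊗ U`: the operator `M^{U⊗2} = (U ⊗ U) M (U ⊗ U)†`. -/
def rotate {d : ℕ} (M : Matrix (Fin d × Fin d) (Fin d × Fin d) ℂ) (U : Matrix (Fin d) (Fin d) ℂ) :
    Matrix (Fin d × Fin d) (Fin d × Fin d) ℂ :=
  (U ⊗ₖ U) * M * (U ⊗ₖ U)ᴴ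

/-- The normalized discrete Fourier transform matrix. -/
noncomputable def F (d : ℕ) : Matrix (Fin d) (Fin d) ℂ :=
  Matrix.of fun j k =>
    1 / (Real.sqrt d : ℂ) *
      Complex.exp (-(2 * Real.pi * Complex.I / d) * ((j : ℕ) : ℂ) * ((k : ℕ) : ℂ))

/-- `B = (1 + i)/2 F + (1 - i)/2 F†`. -/
noncomputable def B (d : ℕ) : Matrix (Fin d) (Fin d) ℂ :=
  ((1 + Complex.I) / 2) • F d + ((1 - Complex.I) / 2) • (F d)ᴴ

/-- The path `Q(t) = exp(i t B)`. -/
noncomputable def Q (d : ℕ) (t : ℝ) : Matrix (Fin d) (Fin d) ℂ :=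
  NormedSpace.exp ((Complex.I * (t : ℂ)) • B d)

/-- The closed form `q(d)` (zero for `d ≡ 1, 2, 4, 5` modulo `8`). -/
noncomputable def q (d : ℕ) : ℝ :=
  if d % 8 = 7 then Real.sqrt d
  else if d % 8 = 3 then -Real.sqrt d
  else if d % 8 = 0 ∨ d % 8 = 6 then Real.sqrt (2 * d)
  else 0

noncomputable def a (d : ℕ) : ℝ :=
  (2 * (d : ℝ) - 1) / 2 - 2 * q d / d - (Nat.gcd 4 d : ℝ) / (2 * d)

noncomputable def b (d : ℕ) : ℝ :=
  -2 * ((d : ℝ) - 1) + 2 * q d / d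

noncomputable def c (d : ℕ) : ℝ :=
  (d : ℝ) - 2 * d / (d + 1)

/-- The discriminant of `a(d) x² + b(d) x + c(d)`. -/
noncomputable def Δ (d : ℕ) : ℝ :=
  b d ^ 2 - 4 * a d * c d

noncomputable def xStar (d : ℕ) : ℝ :=
  (-b d - Real.sqrt (Δ d)) / (2 * a d)

end GroupDesign

/-! The matrix `B d` is the discrete Hartley transform: its entries are the real numbers `h j k =
(cos θ + sin θ)/√d` with `θ = 2πjk/d`, and character orthogonality gives `B² = 1`. The exponential
series therefore splits into `cos t + i sin t B`.

Since `P₁` is a diagonal 0/1 matrix, the trace equals `∑ |Q j k|⁴`, where `|Q j k|² = δ cos² t +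
sin² t · h²`. Only `∑ h⁴` and the diagonal sum `∑ h j j ²` are needed. Orthogonality settles the
former (`sum_hartley_pow_four`). The latter contains `∑ sin(4πj²/d)`, the imaginary part of a
quadratic Gauss sum. Theta inversion near a rational boundary point turns that sum into one modulo 4
(`gaussSum_two_mul_sq`), uniformly in `d`, and `q d` is read off from `d` modulo 8.

With `x = sin² t`, the trace minus `2d/(d+1)` is `a x² + b x + c`. For `d ≥ 2` it has `a > 0`, is
positive at 0 and negative at 1, so exactly one root lies in `[0, 1]`. -/

section GaussSum

/-! ### Gauss sum reciprocity from theta asymptotics. -/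

open Filter Topology Complex

/-- Far up the upper half plane the two-variable theta function at a real point tends to `1`. -/
theorem tendsto_jacobiTheta₂_ofReal {α : Type*} {l : Filter α} [l.IsCountablyGenerated]
    (x : ℝ) {τ : α → ℂ} (hτ : Tendsto (fun i => (τ i).im) l atTop) :
    Tendsto (fun i => jacobiTheta₂ x (τ i)) l (𝓝 1) := by
  have h1 : (∑' n : ℤ, if n = 0 then (1 : ℂ) else 0) = 1 := by simp
  rw [← h1]
  have hs := summable_pow_mul_jacobiTheta₂_term_bound 0 one_pos 0
  simp only [pow_zero, one_mul] at hs
  refine tendsto_tsum_of_dominated_convergence hs (fun n => ?_) ?_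
  · by_cases hn : n = 0
    · simpa [hn, jacobiTheta₂_term] using tendsto_const_nhds
    · rw [if_neg hn, tendsto_zero_iff_norm_tendsto_zero]
      simp only [norm_jacobiTheta₂_term, ofReal_im, mul_zero, sub_zero]
      refine Real.tendsto_exp_atBot.comp ?_
      have : (0 : ℝ) < Real.pi * n ^ 2 := by positivity
      have := hτ.const_mul_atTop_of_neg (neg_lt_zero.mpr this)
      refine this.congr fun i => by ring
  · filter_upwards [hτ.eventually_ge_atTop 1] with i hi n
    simpa using norm_jacobiTheta₂_term_le (S := 0) one_pos (z := x) (by simp) hi n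

theorem ofReal_mul_cpow {r : ℝ} (hr : 0 < r) {z : ℂ} (hz : z ≠ 0) (s : ℂ) :
    ((r : ℂ) * z) ^ s = (r : ℂ) ^ s * z ^ s := by
  have hr' : (r : ℂ) ≠ 0 := ofReal_ne_zero.mpr hr.ne'
  rw [cpow_def_of_ne_zero (mul_ne_zero hr' hz), cpow_def_of_ne_zero hr', cpow_def_of_ne_zero hz,
    log_ofReal_mul hr hz, ofReal_log hr.le, add_mul, exp_add]

theorem ofReal_cpow_half {r : ℝ} (hr : 0 ≤ r) : (r : ℂ) ^ (1 / 2 : ℂ) = (Real.sqrt r : ℂ) := by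
  rw [Real.sqrt_eq_rpow, ofReal_cpow hr]; norm_num

/-- Poisson summation for a Gaussian along a residue class. -/
theorem tsum_gaussian_residueClass {β : ℂ} (hβ : 0 < β.re) {p : ℕ} (hp : 0 < p) (r : ℕ) :
    ∑' m : ℤ, cexp (-Real.pi * β * ((m * p + r : ℤ) : ℂ) ^ 2) =
      1 / (β * p ^ 2) ^ (1 / 2 : ℂ) *
        jacobiTheta₂ ((r / p : ℝ) : ℂ) (I / (β * p ^ 2)) := by
  have hp' : (p : ℂ) ≠ 0 := by exact_mod_cast hp.ne'
  have hβ0 : β ≠ 0 := by rintro rfl; simp at hβ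
  have ha : 0 < (β * p ^ 2).re := by
    have : β * (p : ℂ) ^ 2 = ((p ^ 2 : ℝ) : ℂ) * β := by push_cast; ring
    rw [this, re_ofReal_mul]; positivity
  -- The linear coefficient is the cross term of `(m p + r)²`.
  have h := tsum_exp_neg_quadratic ha (-(β * p * r))
  have e1 : ∀ m : ℤ, cexp (-Real.pi * β * ((m * p + r : ℤ) : ℂ) ^ 2) =
      cexp (-Real.pi * β * r ^ 2) *
        cexp (-Real.pi * (β * p ^ 2) * m ^ 2 + 2 * Real.pi * (-(β * p * r)) * m) := by
    intro m; rw [← exp_add]; push_cast; ring_nf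
  have e2 : ∀ n : ℤ, cexp (-Real.pi * β * r ^ 2) *
      cexp (-Real.pi / (β * p ^ 2) * (n + I * (-(β * p * r))) ^ 2) =
        jacobiTheta₂_term n ((r / p : ℝ) : ℂ) (I / (β * p ^ 2)) := by
    intro n
    rw [jacobiTheta₂_term, ← exp_add]
    congr 1
    push_cast
    field_simp
    ring_nf
    simp only [I_sq]
    ring
  rw [tsum_congr e1, tsum_mul_left, h, mul_left_comm, ← tsum_mul_left, tsum_congr e2,
    jacobiTheta₂]

theorem summable_gaussian {β : ℂ} (hβ : 0 < β.re) :
    Summable fun n : ℤ => cexp (-Real.pi * β * (n : ℂ) ^ 2) := by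
  have := (summable_jacobiTheta₂_term_iff 0 (I * β)).mpr (by simpa using hβ)
  refine this.congr fun n => ?_
  rw [jacobiTheta₂_term]
  congr 1
  linear_combination (Real.pi * β * n ^ 2) * I_sq

/-- A sum over the integers of a periodic function against a Gaussian, split into residue
classes. -/
theorem tsum_periodic_mul_gaussian {β : ℂ} (hβ : 0 < β.re) {p : ℕ} (hp : 0 < p) {f : ℤ → ℂ}
    (hf : ∀ m : ℤ, ∀ r : ℕ, f (m * p + r) = f r) :
    ∑' n : ℤ, f n * cexp (-Real.pi * β * (n : ℂ) ^ 2) =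
      ∑ r : Fin p, f (r : ℕ) *
        ∑' m : ℤ, cexp (-Real.pi * β * ((m * p + (r : ℕ) : ℤ) : ℂ) ^ 2) := by
  have : NeZero p := ⟨hp.ne'⟩
  have hg := summable_gaussian hβ
  have hg' : Summable fun x : ℤ × Fin p =>
      cexp (-Real.pi * β * ((x.1 * p + (x.2 : ℕ) : ℤ) : ℂ) ^ 2) :=
    (Int.divModEquiv p).symm.summable_iff.mpr hg
  have hs : ∀ r : Fin p, Summable fun m : ℤ =>
      cexp (-Real.pi * β * ((m * p + (r : ℕ) : ℤ) : ℂ) ^ 2) := fun r =>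
    hg'.comp_injective (i := fun m : ℤ => (m, r)) fun m m' h => (Prod.mk.inj h).1
  rw [← (Int.divModEquiv p).symm.tsum_eq, ← (Equiv.prodComm (Fin p) ℤ).tsum_eq]
  have hs' : ∀ r : Fin p, Summable fun m : ℤ => f (r : ℕ) *
      cexp (-Real.pi * β * ((m * p + (r : ℕ) : ℤ) : ℂ) ^ 2) := fun r => (hs r).mul_left _
  have key : HasSum (fun x : Fin p × ℤ => f (x.1 : ℕ) *
      cexp (-Real.pi * β * ((x.2 * p + (x.1 : ℕ) : ℤ) : ℂ) ^ 2))
      (∑ r : Fin p, f (r : ℕ) *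
        ∑' m : ℤ, cexp (-Real.pi * β * ((m * p + (r : ℕ) : ℤ) : ℂ) ^ 2)) := by
    have hsum : Summable (fun x : Fin p × ℤ => f (x.1 : ℕ) *
        cexp (-Real.pi * β * ((x.2 * p + (x.1 : ℕ) : ℤ) : ℂ) ^ 2)) := by
      have h2 := ((Equiv.prodComm (Fin p) ℤ).summable_iff.mpr hg').norm.mul_left
        (∑ r : Fin p, ‖f (r : ℕ)‖)
      refine h2.of_norm_bounded fun x => ?_
      rw [norm_mul]
      refine mul_le_mul_of_nonneg_right ?_ (norm_nonneg _)
      exact Finset.single_le_sum (f := fun r : Fin p => ‖f (r : ℕ)‖)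
        (fun _ _ => norm_nonneg _) (Finset.mem_univ x.1)
    have h3 := hsum.tsum_prod' hs'
    simp only [tsum_mul_left] at h3
    exact hsum.hasSum_iff.mpr (h3.trans (tsum_fintype _))
  rw [← key.tsum_eq]
  refine tsum_congr fun x => ?_
  simp only [Equiv.prodComm_apply, Prod.fst_swap, Prod.snd_swap, Int.divModEquiv_symm_apply]
  rw [hf]

/-- Riemann sum asymptotics of a periodic sequence against a widening Gaussian. -/
theorem tendsto_sqrt_mul_tsum_periodic_gaussian {p : ℕ} (hp : 0 < p) {f : ℤ → ℂ}
    (hf : ∀ m : ℤ, ∀ r : ℕ, f (m * p + r) = f r) {u : ℝ → ℂ} {u₀ : ℂ}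
    (hu : Tendsto u (𝓝[>] 0) (𝓝 u₀)) (hu₀ : 0 < u₀.re) :
    Tendsto (fun ε : ℝ => (Real.sqrt ε : ℂ) *
        ∑' n : ℤ, f n * cexp (-Real.pi * (ε * u ε) * (n : ℂ) ^ 2)) (𝓝[>] 0)
      (𝓝 (1 / (p * u₀ ^ (1 / 2 : ℂ)) * ∑ r : Fin p, f (r : ℕ))) := by
  have hp' : (p : ℂ) ≠ 0 := by exact_mod_cast hp.ne'
  have hu₀' : u₀ ≠ 0 := by rintro rfl; simp at hu₀
  have hre : ∀ᶠ ε in 𝓝[>] (0 : ℝ), 0 < (u ε).re :=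
    (continuous_re.continuousAt.tendsto.comp hu).eventually (lt_mem_nhds hu₀)
  have hev : ∀ᶠ ε in 𝓝[>] (0 : ℝ), (Real.sqrt ε : ℂ) *
        ∑' n : ℤ, f n * cexp (-Real.pi * (ε * u ε) * (n : ℂ) ^ 2) =
      1 / (p * (u ε) ^ (1 / 2 : ℂ)) * ∑ r : Fin p, f (r : ℕ) *
        jacobiTheta₂ (((r : ℕ) / p : ℝ) : ℂ) (I / (ε * u ε * p ^ 2)) := by
    filter_upwards [hre, self_mem_nhdsWithin] with ε hε hε0
    have hε0 : 0 < ε := hε0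
    have hβ : 0 < ((ε : ℂ) * u ε).re := by rw [re_ofReal_mul]; positivity
    have hu0 : u ε ≠ 0 := by intro h; simp [h] at hε
    rw [tsum_periodic_mul_gaussian hβ hp hf]
    simp only [tsum_gaussian_residueClass hβ hp]
    have h1 : ((ε : ℂ) * u ε * p ^ 2) ^ (1 / 2 : ℂ) =
        Real.sqrt ε * p * (u ε) ^ (1 / 2 : ℂ) := by
      have : (ε : ℂ) * u ε * p ^ 2 = ((ε * p ^ 2 : ℝ) : ℂ) * u ε := by push_cast; ring
      rw [this, ofReal_mul_cpow (by positivity) hu0, ofReal_cpow_half (by positivity),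
        Real.sqrt_mul hε0.le, Real.sqrt_sq (by positivity)]
      push_cast; ring
    have h2 : (Real.sqrt ε : ℂ) ≠ 0 := by
      exact_mod_cast (Real.sqrt_pos.mpr hε0).ne'
    have h3 : (u ε) ^ (1 / 2 : ℂ) ≠ 0 := by simp [cpow_eq_zero_iff, hu0]
    simp only [h1, Finset.mul_sum]
    refine Finset.sum_congr rfl fun r _ => ?_
    field_simp
  refine Tendsto.congr' (EventuallyEq.symm hev) ?_
  have hc : Tendsto (fun ε => (u ε) ^ (1 / 2 : ℂ)) (𝓝[>] 0) (𝓝 (u₀ ^ (1 / 2 : ℂ))) :=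
    hu.cpow tendsto_const_nhds (Or.inl hu₀)
  have h3 : u₀ ^ (1 / 2 : ℂ) ≠ 0 := by simp [cpow_eq_zero_iff, hu₀']
  refine Tendsto.mul (tendsto_const_nhds.div (tendsto_const_nhds.mul hc) (by positivity)) ?_
  -- This imaginary part is `ε⁻¹ Re(u⁻¹)/p²`. Its divergence sends every theta factor to 1, leaving
  -- the plain sum of `f` over a period.
  have him : Tendsto (fun ε : ℝ => (I / (ε * u ε * p ^ 2)).im) (𝓝[>] 0) atTop := by
    have h4 : Tendsto (fun ε => ((u ε)⁻¹).re / (p : ℝ) ^ 2) (𝓝[>] 0)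
        (𝓝 ((u₀⁻¹).re / (p : ℝ) ^ 2)) :=
      (continuous_re.continuousAt.tendsto.comp (hu.inv₀ hu₀')).div_const _
    have h5 : 0 < (u₀⁻¹).re / (p : ℝ) ^ 2 := by
      rw [inv_re]
      have := normSq_pos.mpr hu₀'
      positivity
    have h6 := (tendsto_inv_nhdsGT_zero (𝕜 := ℝ)).atTop_mul_pos h5 h4
    refine h6.congr fun ε => ?_
    have : I / ((ε : ℂ) * u ε * p ^ 2) = ((ε⁻¹ * ((p : ℝ) ^ 2)⁻¹ : ℝ) : ℂ) * (I * (u ε)⁻¹) := by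
      push_cast
      rw [div_eq_mul_inv, mul_inv, mul_inv]; ring
    rw [this, im_ofReal_mul, I_mul_im]; ring
  have := tendsto_finsetSum (Finset.univ : Finset (Fin p)) fun r _ =>
    (tendsto_jacobiTheta₂_ofReal ((r : ℕ) / p : ℝ) him).const_mul (f (r : ℕ))
  simpa using this

/-- The quadratic Gauss sum `∑ exp (2πi · 2j² / d)` in closed form, for every `d`, by
reciprocity with a sum modulo `4`. -/
theorem gaussSum_two_mul_sq {d : ℕ} (hd : 0 < d) :
    ∑ j : Fin d, cexp (4 * Real.pi * I * ((j : ℕ) : ℂ) ^ 2 / d) =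
      Real.sqrt d / 2 * cexp (Real.pi / 4 * I) *
        ∑ r : Fin 4, cexp (-(Real.pi * I * d * ((r : ℕ) : ℂ) ^ 2 / 4)) := by
  have hd' : (d : ℂ) ≠ 0 := by exact_mod_cast hd.ne'
  have hdr : (0 : ℝ) < d := by exact_mod_cast hd
  let f : ℤ → ℂ := fun n => cexp (4 * Real.pi * I * (n : ℂ) ^ 2 / d)
  let g : ℤ → ℂ := fun n => cexp (-(Real.pi * I * d * (n : ℂ) ^ 2 / 4))
  have hf : ∀ m : ℤ, ∀ r : ℕ, f (m * d + r) = f r := by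
    intro m r
    refine exp_eq_exp_iff_exists_int.mpr ⟨2 * (m * m * d + 2 * m * r), ?_⟩
    push_cast; field_simp; ring
  -- Period 4 suffices because `(4m + r)² ≡ r²` modulo 8.
  have hg : ∀ m : ℤ, ∀ r : ℕ, g (m * (4 : ℕ) + r) = g r := by
    intro m r
    refine exp_eq_exp_iff_exists_int.mpr ⟨-(d * (2 * m * m + m * r)), ?_⟩
    push_cast; field_simp; ring
  have h1 := tendsto_sqrt_mul_tsum_periodic_gaussian hd hf (u := fun _ => 1) (u₀ := 1)
    tendsto_const_nhds (by simp)
  -- With `A = ε - 4i/d`, the function `u` is defined by `1/A = i d/4 + ε u(ε)`: inversion yields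
  -- the phase `g` times a Gaussian that widens again.
  let u : ℝ → ℂ := fun ε => ((d ^ 2 / 16 : ℝ) : ℂ) / (1 + I * ε * d / 4)
  have hu : Tendsto u (𝓝[>] 0) (𝓝 ((d ^ 2 / 16 : ℝ) : ℂ)) := by
    have hc : ContinuousAt u 0 := by
      refine ContinuousAt.div continuousAt_const (by fun_prop) (by simp)
    have := hc.tendsto
    simp only [u, ofReal_zero, mul_zero, zero_mul, zero_div, add_zero, div_one] at this
    exact this.mono_left nhdsWithin_le_nhds
  have h2 := tendsto_sqrt_mul_tsum_periodic_gaussian (by norm_num : 0 < 4) hg hu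
    (by rw [ofReal_re]; positivity)
  have ha : Tendsto (fun ε : ℝ => ((ε : ℂ) + (4 / d : ℝ) * (-I)) ^ (1 / 2 : ℂ)) (𝓝[>] 0)
      (𝓝 (((4 / d : ℝ) * (-I)) ^ (1 / 2 : ℂ))) := by
    refine Tendsto.cpow ?_ tendsto_const_nhds (Or.inr ?_)
    · have : Continuous fun ε : ℝ => (ε : ℂ) + (4 / d : ℝ) * (-I) := by fun_prop
      simpa using (this.tendsto 0).mono_left nhdsWithin_le_nhds
    · rw [im_ofReal_mul]; simp [hd.ne']
  have hval : (((4 / d : ℝ) : ℂ) * (-I)) ^ (1 / 2 : ℂ) =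
      2 / Real.sqrt d * cexp (-(Real.pi / 4 * I)) := by
    rw [ofReal_mul_cpow (by positivity) (by simp), ofReal_cpow_half (by positivity),
      cpow_def_of_ne_zero (by simp), log_neg_I, Real.sqrt_div (by norm_num),
      (by norm_num : (4 : ℝ) = 2 ^ 2), Real.sqrt_sq (by norm_num)]
    push_cast
    congr 2
    ring
  have hne : (((4 / d : ℝ) : ℂ) * (-I)) ^ (1 / 2 : ℂ) ≠ 0 := by
    rw [hval]
    have : (Real.sqrt d : ℂ) ≠ 0 := by exact_mod_cast (Real.sqrt_pos.mpr hdr).ne'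
    simp [exp_ne_zero, this]
  have h3 := (tendsto_const_nhds (x := (1 : ℂ))).div ha hne |>.mul h2
  have h4 : ∀ ε ∈ Set.Ioi (0 : ℝ), (Real.sqrt ε : ℂ) *
      ∑' n : ℤ, f n * cexp (-Real.pi * (ε * 1) * (n : ℂ) ^ 2) =
      1 / ((ε : ℂ) + (4 / d : ℝ) * (-I)) ^ (1 / 2 : ℂ) * ((Real.sqrt ε : ℂ) *
        ∑' n : ℤ, g n * cexp (-Real.pi * (ε * u ε) * (n : ℂ) ^ 2)) := by
    intro ε hε
    have hε : 0 < ε := hε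
    have hA : 0 < ((ε : ℂ) + (4 / d : ℝ) * (-I)).re := by
      rw [add_re, re_ofReal_mul]; simpa using hε
    have hA0 : ((ε : ℂ) + (4 / d : ℝ) * (-I)) ≠ 0 := by intro h; rw [h] at hA; simp at hA
    have hP := tsum_exp_neg_mul_int_sq hA
    suffices h : ∑' n : ℤ, f n * cexp (-Real.pi * (ε * 1) * (n : ℂ) ^ 2) =
        1 / ((ε : ℂ) + (4 / d : ℝ) * (-I)) ^ (1 / 2 : ℂ) *
          ∑' n : ℤ, g n * cexp (-Real.pi * (ε * u ε) * (n : ℂ) ^ 2) by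
      rw [h]; ring
    calc _ = ∑' n : ℤ, cexp (-Real.pi * ((ε : ℂ) + (4 / d : ℝ) * (-I)) * (n : ℂ) ^ 2) := by
          refine tsum_congr fun n => ?_
          simp only [f]
          rw [← exp_add]; push_cast; ring_nf
      _ = _ := by
          rw [hP]
          congr 1
          refine tsum_congr fun n => ?_
          simp only [g, u]
          rw [← exp_add]
          congr 1
          have hB : (1 + I * ε * d / 4 : ℂ) ≠ 0 := by
            intro h
            have := congrArg Complex.re h
            simp [mul_assoc] at this
          have hB' : (4 + I * ε * d : ℂ) ≠ 0 := by
            intro h; apply hB; linear_combination h / 4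
          have hA1 : ((ε : ℂ) + (4 / d : ℝ) * (-I)) = -I * (4 + I * ε * d) / d := by
            push_cast; field_simp; ring_nf; simp only [I_sq]; ring
          rw [hA1]
          have e : (1 + I * ε * d / 4 : ℂ) = (4 + I * ε * d) / 4 := by ring
          rw [e]
          push_cast
          field_simp
          ring_nf
          simp only [I_pow_three, I_sq]
          ring
  -- Both sides of the inversion formula, scaled by `√ε`, have limits; equating them is the
  -- reciprocity law.
  have h5 := tendsto_nhds_unique (h1.congr' (eventually_of_mem self_mem_nhdsWithin h4)) h3
  rw [hval, ofReal_cpow_half (by positivity)] at h5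
  have hsq : Real.sqrt ((d : ℝ) ^ 2 / 16) = d / 4 := by
    rw [show (d : ℝ) ^ 2 / 16 = (d / 4) ^ 2 by ring, Real.sqrt_sq (by positivity)]
  rw [hsq, exp_neg] at h5
  have hs0 : (Real.sqrt d : ℂ) ≠ 0 := by exact_mod_cast (Real.sqrt_pos.mpr hdr).ne'
  have he := exp_ne_zero (Real.pi / 4 * I)
  simp only [one_cpow, mul_one, f, g, Int.cast_natCast] at h5
  push_cast at h5
  have h6 := congrArg (fun z => (d : ℂ) * z) h5
  rw [← mul_assoc, mul_one_div_cancel hd', one_mul] at h6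
  rw [h6]
  field_simp

end GaussSum

namespace GroupDesign

open Complex

open scoped Kronecker Matrix

/-! ### Evaluation of the sine sum modulo 8. -/

theorem sum_sin_four_pi_mul_sq {d : ℕ} (hd : 0 < d) :
    ∑ j : Fin d, Real.sin (4 * Real.pi * ((j : ℕ) : ℝ) ^ 2 / d) =
      Real.sqrt d / 2 * (Real.sqrt 2 / 2 + 2 * Real.sin (Real.pi / 4 - d * (Real.pi / 4)) +
        Real.sin (Real.pi / 4 - d * Real.pi)) := by
  have h := congrArg Complex.im (gaussSum_two_mul_sq hd)
  have e1 : ∀ j : Fin d, (cexp (4 * Real.pi * I * ((j : ℕ) : ℂ) ^ 2 / d)).im =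
      Real.sin (4 * Real.pi * ((j : ℕ) : ℝ) ^ 2 / d) := by
    intro j
    rw [← exp_ofReal_mul_I_im]
    congr 2
    push_cast
    ring
  have e2 : ∀ s : ℝ, (cexp (Real.pi / 4 * I) * cexp (-(Real.pi * I * d * (s : ℂ) / 4))).im =
      Real.sin (Real.pi / 4 - d * s * (Real.pi / 4)) := by
    intro s
    rw [← exp_ofReal_mul_I_im, ← exp_add]
    congr 2
    push_cast
    ring
  -- The residues 1 and 3 modulo 4 have squares 1 and 9, whose phases differ by `2πd`; hence the
  -- factor 2 in the result.
  have e3 : Real.sin (Real.pi / 4 - d * 9 * (Real.pi / 4)) =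
      Real.sin (Real.pi / 4 - d * (Real.pi / 4)) := by
    rw [← Real.sin_sub_nat_mul_two_pi (Real.pi / 4 - d * (Real.pi / 4)) d]
    congr 1
    ring
  have e4 : (Real.sqrt d / 2 : ℂ) = ((Real.sqrt d / 2 : ℝ) : ℂ) := by push_cast; ring
  rw [im_sum, Finset.sum_congr rfl fun j _ => e1 j, mul_assoc, e4, im_ofReal_mul,
    Finset.mul_sum, im_sum, Fin.sum_univ_four] at h
  have f0 := e2 0
  have f1 := e2 1
  have f2 := e2 4
  have f3 := e2 9
  rw [e3] at f3
  norm_num at h f0 f1 f2 f3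
  norm_num [f1, f2, f3] at h
  rw [h, f0]
  ring_nf

theorem sum_sin_eq_q {d : ℕ} (hd : 0 < d) :
    ∑ j : Fin d, Real.sin (4 * Real.pi * ((j : ℕ) : ℝ) ^ 2 / d) = q d := by
  rw [sum_sin_four_pi_mul_sq hd]
  have hs : Real.sqrt (2 * d) = Real.sqrt 2 * Real.sqrt d := Real.sqrt_mul (by norm_num) _
  have p1 : ∀ k r : ℕ, d = 8 * k + r → Real.sin (Real.pi / 4 - d * (Real.pi / 4)) =
      Real.sin (Real.pi / 4 - r * (Real.pi / 4)) := by
    intro k r h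
    rw [← Real.sin_sub_nat_mul_two_pi (Real.pi / 4 - r * (Real.pi / 4)) k, h]
    congr 1
    push_cast
    ring
  have p2 : ∀ k r : ℕ, d = 8 * k + r → Real.sin (Real.pi / 4 - d * Real.pi) =
      Real.sin (Real.pi / 4 - r * Real.pi) := by
    intro k r h
    rw [← Real.sin_sub_nat_mul_two_pi (Real.pi / 4 - r * Real.pi) (4 * k), h]
    congr 1
    push_cast
    ring
  have odd : ∀ r : ℕ, Real.sin (Real.pi / 4 - r * Real.pi) = (-1) ^ r * (Real.sqrt 2 / 2) := by
    intro r
    rw [Real.sin_sub_nat_mul_pi, Real.sin_pi_div_four]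
  have hdec : d = 8 * (d / 8) + d % 8 := by omega
  have hlt : d % 8 < 8 := Nat.mod_lt _ (by norm_num)
  rw [p1 _ _ hdec, p2 _ _ hdec, odd, q, hs]
  generalize d % 8 = r at hlt
  interval_cases r
  · norm_num; ring
  · norm_num
  · have : Real.pi / 4 - (2 : ℕ) * (Real.pi / 4) = -(Real.pi / 4) := by push_cast; ring
    rw [this, Real.sin_neg, Real.sin_pi_div_four]; norm_num; right; ring
  · have : Real.pi / 4 - (3 : ℕ) * (Real.pi / 4) = -(Real.pi / 2) := by push_cast; ring
    rw [this, Real.sin_neg, Real.sin_pi_div_two]; norm_num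
  · have : Real.pi / 4 - (4 : ℕ) * (Real.pi / 4) = Real.pi / 4 - Real.pi := by push_cast; ring
    rw [this, Real.sin_sub_pi, Real.sin_pi_div_four]; norm_num; right; ring
  · have : Real.pi / 4 - (5 : ℕ) * (Real.pi / 4) = -Real.pi := by push_cast; ring
    rw [this, Real.sin_neg, Real.sin_pi]; norm_num
  · have : Real.pi / 4 - (6 : ℕ) * (Real.pi / 4) = -(Real.pi / 4 + Real.pi) := by push_cast; ring
    rw [this, Real.sin_neg, Real.sin_add_pi, Real.sin_pi_div_four]; norm_num; ring
  · have : Real.pi / 4 - (7 : ℕ) * (Real.pi / 4) = Real.pi / 2 - 2 * Real.pi := by push_cast; ring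
    rw [this, Real.sin_sub_two_pi, Real.sin_pi_div_two]; norm_num

/-! ### Character sums and the Hartley matrix. -/

/-- Orthogonality of the characters of `ℤ / d`. -/
theorem sum_exp_two_pi_mul {d : ℕ} (hd : 0 < d) (m : ℤ) :
    ∑ k : Fin d, cexp (((2 * Real.pi * m * ((k : ℕ) : ℝ) / d : ℝ) : ℂ) * I) =
      if (d : ℤ) ∣ m then (d : ℂ) else 0 := by
  have hd' : (d : ℂ) ≠ 0 := by exact_mod_cast hd.ne'
  set ζ : ℂ := cexp (2 * Real.pi * m / d * I) with hζ
  have h1 : ∀ k : ℕ, cexp (((2 * Real.pi * m * (k : ℝ) / d : ℝ) : ℂ) * I) = ζ ^ k := by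
    intro k
    rw [hζ, ← exp_nat_mul]
    congr 1
    push_cast
    ring
  have h2 : ζ ^ d = 1 := by
    rw [hζ, ← exp_nat_mul, exp_eq_one_iff]
    exact ⟨m, by field_simp⟩
  simp only [h1]
  rw [Fin.sum_univ_eq_sum_range (fun k => ζ ^ k)]
  split_ifs with h
  · obtain ⟨n, rfl⟩ := h
    have : ζ = 1 := by
      rw [hζ, exp_eq_one_iff]
      exact ⟨n, by push_cast; field_simp⟩
    simp [this]
  · have hne : ζ ≠ 1 := by
      intro h1
      rw [hζ, exp_eq_one_iff] at h1
      obtain ⟨n, hn⟩ := h1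
      refine h ⟨n, ?_⟩
      have hpi : (Real.pi : ℂ) ≠ 0 := by exact_mod_cast Real.pi_ne_zero
      have hI := I_ne_zero
      field_simp at hn
      exact_mod_cast hn
    rw [geom_sum_eq hne, h2, sub_self, zero_div]

theorem sum_cos_two_pi_mul {d : ℕ} (hd : 0 < d) (m : ℤ) :
    ∑ k : Fin d, Real.cos (2 * Real.pi * m * ((k : ℕ) : ℝ) / d) =
      if (d : ℤ) ∣ m then (d : ℝ) else 0 := by
  have h := congrArg Complex.re (sum_exp_two_pi_mul hd m)
  rw [re_sum] at h
  simp only [exp_ofReal_mul_I_re] at h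
  rw [h]
  split_ifs <;> simp

theorem sum_sin_two_pi_mul {d : ℕ} (hd : 0 < d) (m : ℤ) :
    ∑ k : Fin d, Real.sin (2 * Real.pi * m * ((k : ℕ) : ℝ) / d) = 0 := by
  have h := congrArg Complex.im (sum_exp_two_pi_mul hd m)
  rw [im_sum] at h
  simp only [exp_ofReal_mul_I_im] at h
  rw [h]
  split_ifs <;> simp

/-- The discrete Hartley kernel, the real entries of `B`. -/
noncomputable def hartley (d : ℕ) (j k : Fin d) : ℝ :=
  (Real.cos (2 * Real.pi * ((j : ℕ) : ℝ) * ((k : ℕ) : ℝ) / d) +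
    Real.sin (2 * Real.pi * ((j : ℕ) : ℝ) * ((k : ℕ) : ℝ) / d)) / Real.sqrt d

theorem F_apply (d : ℕ) (j k : Fin d) :
    F d j k = 1 / (Real.sqrt d : ℂ) *
      ((Real.cos (2 * Real.pi * ((j : ℕ) : ℝ) * ((k : ℕ) : ℝ) / d) : ℂ) -
        (Real.sin (2 * Real.pi * ((j : ℕ) : ℝ) * ((k : ℕ) : ℝ) / d) : ℂ) * I) := by
  have : -(2 * Real.pi * I / d) * ((j : ℕ) : ℂ) * ((k : ℕ) : ℂ) =
      ((-(2 * Real.pi * ((j : ℕ) : ℝ) * ((k : ℕ) : ℝ) / d) : ℝ) : ℂ) * I := by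
    push_cast
    ring
  rw [F, Matrix.of_apply, this, exp_mul_I, ← ofReal_cos, ← ofReal_sin, Real.cos_neg, Real.sin_neg]
  push_cast
  ring

/-- As `F` is symmetric, the entry is `Re((1 + i)(cos θ - i sin θ))/√d`. -/
theorem B_apply (d : ℕ) (j k : Fin d) : B d j k = (hartley d j k : ℂ) := by
  rw [B, Matrix.add_apply, Matrix.smul_apply, Matrix.smul_apply, Matrix.conjTranspose_apply,
    F_apply, F_apply, hartley, mul_right_comm (2 * Real.pi) ((k : ℕ) : ℝ)]
  simp only [Complex.star_def, map_mul, map_sub, map_div₀, map_one, conj_ofReal, conj_I,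
    smul_eq_mul]
  push_cast
  linear_combination (-(1 / (Real.sqrt d : ℂ)) *
    (Complex.sin (2 * Real.pi * ((j : ℕ) : ℂ) * ((k : ℕ) : ℂ) / d))) * I_sq

/-- The product `(cos x + sin x)(cos y + sin y)` is `cos(x - y) + sin(x + y)`; the sine part sums to
zero and the cosine part detects `j = l`. -/
theorem B_mul_B {d : ℕ} (hd : 0 < d) : B d * B d = 1 := by
  have hdr : (0 : ℝ) < d := by exact_mod_cast hd
  have hs : Real.sqrt d * Real.sqrt d = d := Real.mul_self_sqrt hdr.le
  ext j l
  rw [Matrix.mul_apply]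
  simp only [B_apply]
  have key : ∑ k : Fin d, hartley d j k * hartley d k l = if j = l then 1 else 0 := by
    have e : ∀ k : Fin d, hartley d j k * hartley d k l =
        (Real.cos (2 * Real.pi * (((j : ℕ) - (l : ℕ) : ℤ) : ℝ) * ((k : ℕ) : ℝ) / d) +
          Real.sin (2 * Real.pi * (((j : ℕ) + (l : ℕ) : ℤ) : ℝ) * ((k : ℕ) : ℝ) / d)) / d := by
      intro k
      have a1 : 2 * Real.pi * (((j : ℕ) - (l : ℕ) : ℤ) : ℝ) * ((k : ℕ) : ℝ) / d =
          2 * Real.pi * ((j : ℕ) : ℝ) * ((k : ℕ) : ℝ) / d -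
            2 * Real.pi * ((k : ℕ) : ℝ) * ((l : ℕ) : ℝ) / d := by push_cast; ring
      have a2 : 2 * Real.pi * (((j : ℕ) + (l : ℕ) : ℤ) : ℝ) * ((k : ℕ) : ℝ) / d =
          2 * Real.pi * ((j : ℕ) : ℝ) * ((k : ℕ) : ℝ) / d +
            2 * Real.pi * ((k : ℕ) : ℝ) * ((l : ℕ) : ℝ) / d := by push_cast; ring
      rw [hartley, hartley, div_mul_div_comm, hs, a1, a2, Real.cos_sub, Real.sin_add]
      ring
    simp only [e]
    rw [← Finset.sum_div, Finset.sum_add_distrib, sum_cos_two_pi_mul hd, sum_sin_two_pi_mul hd,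
      add_zero]
    have : (d : ℤ) ∣ ((j : ℕ) - (l : ℕ) : ℤ) ↔ j = l := by
      constructor
      · intro h
        have := Int.eq_zero_of_abs_lt_dvd h (by rw [abs_lt]; omega)
        ext; omega
      · rintro rfl; simp
    simp only [this]
    split_ifs
    · exact div_self hdr.ne'
    · exact zero_div _
  rw [Matrix.one_apply]
  have := congrArg (fun x : ℝ => (x : ℂ)) key
  rw [← ofReal_one, ← ofReal_zero, ← apply_ite ofReal, ← this]
  push_cast
  rfl

theorem hartley_sq {d : ℕ} (j k : Fin d) :
    hartley d j k ^ 2 =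
      (1 + Real.sin (2 * (2 * Real.pi * ((j : ℕ) : ℝ) * ((k : ℕ) : ℝ) / d))) / d := by
  rw [hartley, div_pow, Real.sq_sqrt (by positivity), Real.sin_two_mul]
  congr 1
  linear_combination Real.sin_sq_add_cos_sq (2 * Real.pi * ((j : ℕ) : ℝ) * ((k : ℕ) : ℝ) / d)

theorem sum_hartley_diag_sq {d : ℕ} (hd : 0 < d) :
    ∑ j : Fin d, hartley d j j ^ 2 = 1 + q d / d := by
  have hdr : (d : ℝ) ≠ 0 := by exact_mod_cast hd.ne'
  simp only [hartley_sq]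
  rw [← Finset.sum_div, Finset.sum_add_distrib, ← sum_sin_eq_q hd]
  simp only [Finset.sum_const, Finset.card_univ, Fintype.card_fin, nsmul_eq_mul, mul_one, add_div,
    div_self hdr]
  congr 3
  ext j
  congr 1
  ring

/-- Writing `d = g e` with `g = gcd(m, d)`, the condition becomes `e ∣ j`, and there are `g`
multiples of `e` in `[0, d)`. -/
theorem card_dvd_mul {d : ℕ} (hd : 0 < d) (m : ℕ) :
    (Finset.univ.filter fun j : Fin d => (d : ℤ) ∣ ((m * (j : ℕ) : ℕ) : ℤ)).card =
      Nat.gcd m d := by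
  set g := Nat.gcd m d with hg
  have hgpos : 0 < g := Nat.gcd_pos_of_pos_right _ hd
  obtain ⟨e, he⟩ : g ∣ d := Nat.gcd_dvd_right m d
  have hepos : 0 < e := Nat.pos_of_mul_pos_left (he ▸ hd)
  have hiff : ∀ j : ℕ, (d : ℤ) ∣ ((m * j : ℕ) : ℤ) ↔ e ∣ j := by
    intro j
    obtain ⟨m', hm⟩ : g ∣ m := Nat.gcd_dvd_left m d
    have hcop : Nat.Coprime e m' := by
      have := Nat.coprime_div_gcd_div_gcd (m := m) (n := d) hgpos
      rw [← hg, hm, Nat.mul_div_cancel_left _ hgpos] at this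
      conv at this => rw [he, Nat.mul_div_cancel_left _ hgpos]
      exact this.symm
    rw [Int.natCast_dvd_natCast]
    conv_lhs => rw [he, hm, mul_assoc]
    rw [Nat.mul_dvd_mul_iff_left hgpos]
    exact ⟨fun h => hcop.dvd_of_dvd_mul_left h, fun h => h.mul_left _⟩
  simp only [hiff]
  have : (Finset.univ.filter fun j : Fin d => e ∣ (j : ℕ)).card = (Finset.range g).card := by
    symm
    refine Finset.card_bij (fun i hi => ⟨e * i, ?_⟩) ?_ ?_ ?_
    · rw [he, mul_comm]; exact Nat.mul_lt_mul_of_pos_right (Finset.mem_range.mp hi) hepos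
    · intro i hi; simp
    · intro i hi i' hi' h
      exact Nat.eq_of_mul_eq_mul_left hepos (Fin.mk.inj h)
    · intro j hj
      obtain ⟨i, hi⟩ := (Finset.mem_filter.mp hj).2
      refine ⟨i, ?_, Fin.ext hi.symm⟩
      rw [Finset.mem_range]
      have h := j.2
      rw [hi, he, mul_comm] at h
      exact Nat.lt_of_mul_lt_mul_right h
  rw [this, Finset.card_range]

/-- From `(1 + sin 2θ)² = 3/2 + 2 sin 2θ - (1/2) cos 4θ`: summing over `k` kills the sine, and the
cosine survives only in the `gcd(4, d)` rows with `d ∣ 4j`. -/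
theorem sum_hartley_pow_four {d : ℕ} (hd : 0 < d) :
    ∑ j : Fin d, ∑ k : Fin d, hartley d j k ^ 4 = 3 / 2 - (Nat.gcd 4 d : ℝ) / (2 * d) := by
  have hdr : (d : ℝ) ≠ 0 := by exact_mod_cast hd.ne'
  have e : ∀ j k : Fin d, hartley d j k ^ 4 =
      (3 / 2 + 2 * Real.sin (2 * Real.pi * (((2 * (j : ℕ) : ℕ) : ℤ) : ℝ) * ((k : ℕ) : ℝ) / d) -
        1 / 2 * Real.cos (2 * Real.pi * (((4 * (j : ℕ) : ℕ) : ℤ) : ℝ) * ((k : ℕ) : ℝ) / d)) /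
          d ^ 2 := by
    intro j k
    have a1 : 2 * Real.pi * (((2 * (j : ℕ) : ℕ) : ℤ) : ℝ) * ((k : ℕ) : ℝ) / d =
        2 * (2 * Real.pi * ((j : ℕ) : ℝ) * ((k : ℕ) : ℝ) / d) := by push_cast; ring
    have a2 : 2 * Real.pi * (((4 * (j : ℕ) : ℕ) : ℤ) : ℝ) * ((k : ℕ) : ℝ) / d =
        2 * (2 * (2 * Real.pi * ((j : ℕ) : ℝ) * ((k : ℕ) : ℝ) / d)) := by push_cast; ring
    rw [show hartley d j k ^ 4 = (hartley d j k ^ 2) ^ 2 by ring, hartley_sq, div_pow, a1, a2,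
      Real.cos_two_mul, Real.cos_sq']
    congr 1
    ring
  have inner : ∀ j : Fin d, ∑ k : Fin d, hartley d j k ^ 4 =
      (3 / 2 * d - 1 / 2 * (if (d : ℤ) ∣ ((4 * (j : ℕ) : ℕ) : ℤ) then (d : ℝ) else 0)) / d ^ 2 := by
    intro j
    simp only [e]
    rw [← Finset.sum_div, Finset.sum_sub_distrib, Finset.sum_add_distrib, ← Finset.mul_sum,
      ← Finset.mul_sum, sum_sin_two_pi_mul hd, sum_cos_two_pi_mul hd]
    simp
    ring
  simp only [inner]
  rw [← Finset.sum_div, Finset.sum_sub_distrib, ← Finset.mul_sum, ← Finset.mul_sum, ← Finset.sum_filter]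
  simp only [Finset.sum_const, card_dvd_mul hd, Finset.card_univ, Fintype.card_fin, nsmul_eq_mul]
  field_simp

/-! ### The projection, the path and the trace. -/

theorem P₁_eq_diagonal (d : ℕ) :
    P₁ d = Matrix.diagonal fun p : Fin d × Fin d => if p.1 = p.2 then (1 : ℂ) else 0 := by
  rw [P₁, LinearEquiv.symm_apply_eq]
  ext v : 1
  -- A projection is characterised by its value lying in the subspace and the residual being
  -- orthogonal to it.
  refine Submodule.eq_starProjection_of_mem_of_inner_eq_zero ?_ ?_
  · have : (Matrix.toEuclideanLin (Matrix.diagonal fun p : Fin d × Fin d =>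
        if p.1 = p.2 then (1 : ℂ) else 0)) v =
        ∑ j : Fin d, v (j, j) • EuclideanSpace.single (j, j) (1 : ℂ) := by
      ext ⟨x, y⟩
      simp [Matrix.toLpLin_apply, Matrix.mulVec_diagonal, Pi.single_apply, Prod.ext_iff]
      split_ifs with hxy
      · subst hxy; simp
      · symm
        refine Finset.sum_eq_zero fun j _ => if_neg ?_
        rintro ⟨rfl, h⟩
        exact hxy h.symm
    rw [this]
    exact Submodule.sum_mem _ fun j _ => Submodule.smul_mem _ _ (Submodule.subset_span ⟨j, rfl⟩)
  · intro w hw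
    induction hw using Submodule.span_induction with
    | mem x hx =>
      obtain ⟨j, rfl⟩ := hx
      simp [EuclideanSpace.inner_single_right, Matrix.toLpLin_apply,
        Matrix.mulVec_diagonal]
    | zero => simp
    | add x y _ _ hx hy => rw [inner_add_right, hx, hy, add_zero]
    | smul c x _ hx => rw [inner_smul_right, hx, mul_zero]

theorem trace_P₁_mul_rotate {d : ℕ} (U : Matrix (Fin d) (Fin d) ℂ) :
    Matrix.trace (P₁ d * rotate (P₁ d) U) =
      ((∑ j : Fin d, ∑ k : Fin d, normSq (U j k) ^ 2 : ℝ) : ℂ) := by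
  have h : ∀ (K : Matrix (Fin d × Fin d) (Fin d × Fin d) ℂ) (v : Fin d × Fin d → ℂ) p,
      (K * Matrix.diagonal v * Kᴴ) p p = ∑ r, K p r * v r * star (K p r) := fun K v p => by
    rw [Matrix.mul_apply]
    simp only [Matrix.mul_diagonal, Matrix.conjTranspose_apply]
  rw [P₁_eq_diagonal, rotate, Matrix.trace]
  simp only [Matrix.diag_apply, Matrix.diagonal_mul, h, Matrix.kroneckerMap_apply,
    Fintype.sum_prod_type]
  simp only [ite_mul, one_mul, zero_mul, mul_ite, mul_one, mul_zero, Finset.sum_ite_eq,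
    Finset.mem_univ, if_true]
  push_cast
  refine Finset.sum_congr rfl fun j _ => Finset.sum_congr rfl fun k _ => ?_
  rw [normSq_eq_conj_mul_self, star_mul, Complex.star_def]
  ring

/-- Even powers of `B` are 1 and odd powers are `B`, so the two halves of the series are those of
cosine and sine. -/
theorem Q_eq {d : ℕ} (hd : 0 < d) (t : ℝ) :
    Q d t = (Real.cos t : ℂ) • (1 : Matrix (Fin d) (Fin d) ℂ)
      + (I * (Real.sin t : ℂ)) • B d := by
  have hpow : ∀ n : ℕ, B d ^ (2 * n) = 1 := fun n => by
    rw [pow_mul, pow_two, B_mul_B hd, one_pow]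
  rw [Q, NormedSpace.exp_eq_tsum ℂ]
  refine HasSum.tsum_eq (HasSum.even_add_odd ?_ ?_)
  · have h := (Complex.hasSum_cos' t).smul_const (1 : Matrix (Fin d) (Fin d) ℂ)
    rw [ofReal_cos]
    refine Eq.subst (motive := fun f => HasSum f _) (funext fun n => ?_) h
    symm
    rw [smul_pow, hpow, smul_smul]
    congr 1
    rw [mul_comm I]
    ring
  · have h := ((Complex.hasSum_sin' t).mul_left I).smul_const (B d)
    rw [ofReal_sin]
    refine Eq.subst (motive := fun f => HasSum f _) (funext fun n => ?_) h
    symm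
    rw [smul_pow, pow_succ (B d), hpow, one_mul, smul_smul]
    congr 1
    rw [mul_comm I (t : ℂ), mul_div_cancel₀ _ I_ne_zero]
    ring

theorem normSq_Q {d : ℕ} (hd : 0 < d) (t : ℝ) (j k : Fin d) :
    normSq (Q d t j k) =
      (if j = k then Real.cos t ^ 2 else 0) + Real.sin t ^ 2 * hartley d j k ^ 2 := by
  rw [Q_eq hd, Matrix.add_apply, Matrix.smul_apply, Matrix.smul_apply, B_apply, Matrix.one_apply,
    normSq_apply]
  generalize Real.cos t = x, Real.sin t = y
  split_ifs <;> simp <;> ring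

theorem trace_P₁_mul_rotate_Q {d : ℕ} (hd : 0 < d) (t : ℝ) :
    Matrix.trace (P₁ d * rotate (P₁ d) (Q d t)) =
      ((a d * Real.sin t ^ 4 + b d * Real.sin t ^ 2 + (d : ℝ) : ℝ) : ℂ) := by
  rw [trace_P₁_mul_rotate]
  congr 1
  have e : ∀ j k : Fin d, normSq (Q d t j k) ^ 2 =
      Real.sin t ^ 4 * hartley d j k ^ 4 + if j = k then Real.cos t ^ 4 +
        2 * Real.cos t ^ 2 * Real.sin t ^ 2 * hartley d j k ^ 2 else 0 := by
    intro j k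
    rw [normSq_Q hd]
    split_ifs <;> ring
  simp only [e, Finset.sum_add_distrib, Finset.sum_ite_eq, Finset.mem_univ, if_true,
    ← Finset.mul_sum]
  rw [sum_hartley_pow_four hd, sum_hartley_diag_sq hd]
  simp only [Finset.sum_const, Finset.card_univ, Fintype.card_fin, nsmul_eq_mul]
  have hc : Real.cos t ^ 2 = 1 - Real.sin t ^ 2 := Real.cos_sq' t
  rw [show Real.cos t ^ 4 = (Real.cos t ^ 2) ^ 2 by ring, hc, a, b]
  have hdr : (d : ℝ) ≠ 0 := by exact_mod_cast hd.ne'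
  field_simp
  ring

end GroupDesign

namespace GroupDesign

/-! ### Locating the root of the quadratic. -/

theorem sq_sin_eq_iff (t θ : ℝ) :
    Real.sin t ^ 2 = Real.sin θ ^ 2 ↔
      ∃ k : ℤ, t = θ + (k : ℝ) * Real.pi ∨ t = -θ + (k : ℝ) * Real.pi := by
  have h : Real.sin t ^ 2 = Real.sin θ ^ 2 ↔ Real.cos (2 * θ) = Real.cos (2 * t) := by
    rw [Real.cos_two_mul, Real.cos_two_mul, Real.cos_sq', Real.cos_sq']
    constructor <;> intro h <;> linarith
  rw [h, Real.cos_eq_cos_iff]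
  refine exists_congr fun k => or_congr ?_ ?_ <;> constructor <;> intro h <;> linarith

theorem q_le_sqrt (d : ℕ) : q d ≤ Real.sqrt (2 * d) := by
  have h1 : Real.sqrt d ≤ Real.sqrt (2 * d) :=
    Real.sqrt_le_sqrt (by linarith [d.cast_nonneg (α := ℝ)])
  have h2 := Real.sqrt_nonneg (d : ℝ)
  rw [q]
  split_ifs <;> linarith

theorem two_mul_q_div_lt {d : ℕ} (hd : 2 ≤ d) : 2 * q d / d < d - 1 := by
  have hdr : (2 : ℝ) ≤ d := by exact_mod_cast hd
  -- The first `d ≥ 2` with `q d > 0` is 6; from there the crude bound `q d ≤ √(2d) ≤ d` is enough.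
  rcases Nat.lt_or_ge d 6 with h | h
  · have : q d ≤ 0 := by
      rw [q]
      have h3 : d % 8 ≠ 7 := by omega
      have h4 : ¬(d % 8 = 0 ∨ d % 8 = 6) := by omega
      rw [if_neg h3, if_neg h4]
      split_ifs
      · linarith [Real.sqrt_nonneg (d : ℝ)]
      · exact le_rfl
    have : 2 * q d / d ≤ 0 := div_nonpos_of_nonpos_of_nonneg (by linarith) (by linarith)
    linarith
  · have h6 : (6 : ℝ) ≤ d := by exact_mod_cast h
    have h1 : Real.sqrt (2 * d) ≤ d := by
      rw [Real.sqrt_le_left (by linarith)]; nlinarith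
    have : 2 * q d / d ≤ 2 := by
      rw [div_le_iff₀ (by linarith)]; linarith [q_le_sqrt d]
    linarith

theorem a_pos {d : ℕ} (hd : 2 ≤ d) : 0 < a d := by
  have hdr : (2 : ℝ) ≤ d := by exact_mod_cast hd
  have hg : (Nat.gcd 4 d : ℝ) ≤ d := by
    exact_mod_cast Nat.gcd_le_right 4 (by omega : 0 < d)
  have hg' : (Nat.gcd 4 d : ℝ) / (2 * d) ≤ 1 / 2 := by
    rw [div_le_iff₀ (by linarith)]; linarith
  have := two_mul_q_div_lt hd
  rw [a]
  linarith

theorem c_pos {d : ℕ} (hd : 2 ≤ d) : 0 < c d := by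
  have hdr : (2 : ℝ) ≤ d := by exact_mod_cast hd
  have : 2 * (d : ℝ) / (d + 1) < d := by
    rw [div_lt_iff₀ (by linarith)]; nlinarith
  rw [c]
  linarith

theorem a_add_b_add_c_neg {d : ℕ} (hd : 2 ≤ d) : a d + b d + c d < 0 := by
  have hdr : (2 : ℝ) ≤ d := by exact_mod_cast hd
  have hg : 0 < (Nat.gcd 4 d : ℝ) / (2 * d) := by
    have : 0 < Nat.gcd 4 d := Nat.gcd_pos_of_pos_left _ (by norm_num)
    positivity
  have h : a d + b d + c d = 3 / 2 - 2 * (d : ℝ) / (d + 1) - (Nat.gcd 4 d : ℝ) / (2 * d) := by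
    rw [a, b, c]; ring
  rw [h]
  -- The `q` terms have cancelled. Only at `d = 2` is `2d/(d+1)` below `3/2`, and there the gcd term
  -- compensates.
  rcases eq_or_lt_of_le hd with rfl | h3
  · norm_num
  · have h3 : (3 : ℝ) ≤ d := by exact_mod_cast h3
    have : 3 / 2 ≤ 2 * (d : ℝ) / (d + 1) := by
      rw [le_div_iff₀ (by linarith)]; linarith
    linarith

/-- A convex quadratic that is positive at `0` and negative at `1` has its smaller root in `(0, 1)`
and no other root in `[0, 1]`. -/
theorem smaller_root_of_pos_of_neg {a b c : ℝ} (ha : 0 < a) (hc : 0 < c) (h1 : a + b + c < 0) :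
    0 ≤ b ^ 2 - 4 * a * c ∧
      0 < (-b - Real.sqrt (b ^ 2 - 4 * a * c)) / (2 * a) ∧
      (-b - Real.sqrt (b ^ 2 - 4 * a * c)) / (2 * a) < 1 ∧
      a * ((-b - Real.sqrt (b ^ 2 - 4 * a * c)) / (2 * a)) ^ 2 +
        b * ((-b - Real.sqrt (b ^ 2 - 4 * a * c)) / (2 * a)) + c = 0 ∧
      ∀ y ≤ 1, a * y ^ 2 + b * y + c = 0 →
        y = (-b - Real.sqrt (b ^ 2 - 4 * a * c)) / (2 * a) := by
  -- The difference of the two sides is `-4a(a + b + c)`. Consequently `|2a + b|` is less than the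
  -- root of the discriminant, which puts 1 strictly between the two roots.
  have hD : (2 * a + b) ^ 2 < b ^ 2 - 4 * a * c := by nlinarith
  have hD0 : 0 ≤ b ^ 2 - 4 * a * c := (sq_nonneg _).trans hD.le
  have hs := Real.sq_sqrt hD0
  have hs0 := Real.sqrt_nonneg (b ^ 2 - 4 * a * c)
  have hsb : |2 * a + b| < Real.sqrt (b ^ 2 - 4 * a * c) := Real.lt_sqrt_of_sq_lt (by rwa [sq_abs])
  obtain ⟨hl, hr⟩ := abs_lt.mp hsb
  have hlt : Real.sqrt (b ^ 2 - 4 * a * c) < -b := by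
    rw [Real.sqrt_lt' (by linarith)]
    nlinarith [mul_pos ha hc]
  set s := Real.sqrt (b ^ 2 - 4 * a * c)
  have hroot : a * ((-b - s) / (2 * a)) ^ 2 + b * ((-b - s) / (2 * a)) + c = 0 := by
    field_simp
    linear_combination hs
  refine ⟨hD0, div_pos (by linarith) (by linarith), ?_, hroot, fun y hy h => ?_⟩
  · rw [div_lt_one (by linarith)]; linarith
  · have hf : (2 * a * y + b - s) * (2 * a * y + b + s) = 0 := by
      linear_combination 4 * a * h - hs
    rcases mul_eq_zero.mp hf with h | h
    · nlinarith
    · rw [eq_div_iff (by linarith)]; linarith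

end GroupDesign

theorem mainTheorem9 (d : ℕ) (hd : 1 ≤ d) :
    (∀ t : ℝ,
      GroupDesign.Q d t = (Real.cos t : ℂ) • (1 : Matrix (Fin d) (Fin d) ℂ)
        + (Complex.I * (Real.sin t : ℂ)) • GroupDesign.B d) ∧
    (∀ t : ℝ,
      Matrix.trace (GroupDesign.P₁ d * GroupDesign.rotate (GroupDesign.P₁ d) (GroupDesign.Q d t)) =
        ((GroupDesign.a d * Real.sin t ^ 4 + GroupDesign.b d * Real.sin t ^ 2 + (d : ℝ) : ℝ) : ℂ)) ∧
    (2 ≤ d →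
      GroupDesign.a d ≠ 0 ∧ 0 ≤ GroupDesign.Δ d ∧
      0 < GroupDesign.xStar d ∧ GroupDesign.xStar d < 1 ∧
      GroupDesign.a d * GroupDesign.xStar d ^ 2 + GroupDesign.b d * GroupDesign.xStar d
        + GroupDesign.c d = 0 ∧
      ∀ t : ℝ,
        Matrix.trace
            (GroupDesign.P₁ d * GroupDesign.rotate (GroupDesign.P₁ d) (GroupDesign.Q d t)) =
          ((2 * (d : ℝ) / ((d : ℝ) + 1) : ℝ) : ℂ) ↔
        ∃ k : ℤ,
          t = Real.arcsin (Real.sqrt (GroupDesign.xStar d)) + (k : ℝ) * Real.pi ∨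
          t = -Real.arcsin (Real.sqrt (GroupDesign.xStar d)) + (k : ℝ) * Real.pi) := by
  refine ⟨GroupDesign.Q_eq hd, GroupDesign.trace_P₁_mul_rotate_Q hd, fun hd2 => ?_⟩
  have ha := GroupDesign.a_pos hd2
  obtain ⟨hΔ, hx0, hx1, hroot, huniq⟩ := GroupDesign.smaller_root_of_pos_of_neg ha
    (GroupDesign.c_pos hd2) (GroupDesign.a_add_b_add_c_neg hd2)
  change 0 ≤ GroupDesign.Δ d at hΔ
  change 0 < GroupDesign.xStar d at hx0
  change GroupDesign.xStar d < 1 at hx1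
  change GroupDesign.a d * GroupDesign.xStar d ^ 2 + GroupDesign.b d * GroupDesign.xStar d +
    GroupDesign.c d = 0 at hroot
  change ∀ y ≤ 1, GroupDesign.a d * y ^ 2 + GroupDesign.b d * y + GroupDesign.c d = 0 →
    y = GroupDesign.xStar d at huniq
  refine ⟨ha.ne', hΔ, hx0, hx1, hroot, fun t => ?_⟩
  have hsin : Real.sin (Real.arcsin (Real.sqrt (GroupDesign.xStar d))) ^ 2 =
      GroupDesign.xStar d := by
    rw [Real.sin_arcsin (by linarith [Real.sqrt_nonneg (GroupDesign.xStar d)])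
      (Real.sqrt_le_one.mpr hx1.le), Real.sq_sqrt hx0.le]
  rw [GroupDesign.trace_P₁_mul_rotate_Q hd, Complex.ofReal_inj, ← GroupDesign.sq_sin_eq_iff, hsin]
  have hc : GroupDesign.c d = d - 2 * (d : ℝ) / (d + 1) := rfl
  constructor
  · intro h
    refine huniq _ (Real.sin_sq_le_one t) ?_
    rw [hc]
    linear_combination h
  · intro h
    rw [← h, hc] at hroot
    linear_combination hroot
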